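/- A graph $G$ is a \emph{unit distance graph} in $\mathbb{R}^d$ if its vertices can be assigned to distinct points of $\mathbb{R}^d$ (with the Euclidean metric) so that any two adjacent vertices are assigned to points at distance exactly $1$ (points at distance $1$ need not come from adjacent vertices). The girth of $G$ is the length of a shortest cycle of $G$, and is $\infty$ if $G$ has no cycle; $\chi(G)$ is the chromatic number of $G$. \textbf{Theorem.} There is a sequence of real numbers $(\varepsilon_d)_{d\ge 0}$ with $\varepsilon_d\to 0$ as $d\to\infty$ such that for every dimension $d$ and every integer $g\ge 0$ there exists a finite unit distance graph $G$ in $\mathbb{R}^d$ with girth at least $g$ and $$\chi(G)\ \ge\ (1.074+\varepsilon_d)^d .$$ In particular, the $o(1)$ term $\varepsilon_d$ does not depend on $g$. -/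

import Mathlib

open Filter Topology

/-- `G` is a unit distance graph in `ℝ^d`: its vertices can be assigned to distinct points of
Euclidean `d`-space so that adjacent vertices are at distance one. The assignment need not be
faithful: nonadjacent vertices may also be at distance one. -/
def IsUnitDistanceGraph {V : Type*} (d : ℕ) (G : SimpleGraph V) : Prop :=
  ∃ φ : V → EuclideanSpace ℝ (Fin d),
    Function.Injective φ ∧ ∀ u v : V, G.Adj u v → dist (φ u) (φ v) = 1

/-! For a suitable prime `p`, the Frankl–Wilson graph on the `(2p-1)`-subsets has independence ratio
at most `1.09 ^ (-d)`, but it may have short cycles. Its box powers stay in the same dimension: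
summing generically reflected copies of the embedding is injective and keeps every edge of length
one (`exists_linearIsometryEquiv_sum_injective`).

In the `m`-th power, both the degree bound and the number of edges per vertex guaranteed inside a
set of twice the independence ratio grow linearly in `m` (`SimpleGraph.card_edges_boxPower_ge`).
Keep each edge with probability `1/q`. For `q` large in terms of `g`, few vertices lie on short
cycles; for `m` proportional to `q`, a union bound shows that every dense set keeps an edge
(`SimpleGraph.exists_sparse_subgraph`). Deleting the vertices on short cycles leaves at least half
of all vertices, so the chromatic number is at least `1.09 ^ d / 4`, whatever `g` is. The slack
between `1.09` and `1.074` absorbs the factor 4. -/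

/-! ### Random sparsification, by counting colourings. -/

open Finset in
theorem card_filter_forall_mem {α β : Type*} [Fintype α] [DecidableEq α] [Fintype β]
    [DecidableEq β] (T : Finset α) (A : Finset β) :
    #{f : α → β | ∀ e ∈ T, f e ∈ A} * Fintype.card β ^ #T =
      #A ^ #T * Fintype.card β ^ Fintype.card α := by
  have h : ({f : α → β | ∀ e ∈ T, f e ∈ A} : Finset (α → β)) =
      Fintype.piFinset (fun e => if e ∈ T then A else univ) := by
    ext f
    simp only [mem_filter, mem_univ, true_and, Fintype.mem_piFinset]
    refine forall_congr' fun e => ?_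
    by_cases he : e ∈ T <;> simp [he]
  rw [h, Fintype.card_piFinset]
  have h2 : ∀ e, #(if e ∈ T then A else univ) = if e ∈ T then #A else Fintype.card β := by
    intro e; split_ifs <;> simp
  simp only [h2, prod_ite, prod_const, filter_mem_eq_inter, univ_inter]
  rw [show ({x | x ∉ T} : Finset α) = Tᶜ by ext; simp, mul_assoc, ← pow_add, card_compl_add_card]

-- The fixed endpoint forces the last step, so only `n` of the `n + 1` steps are free. This saved
-- factor makes short cycles rare after sparsification.
open Finset in
theorem SimpleGraph.card_finsetWalkLength_succ_le {V : Type*} [Fintype V] [DecidableEq V]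
    (H : SimpleGraph V) [DecidableRel H.Adj] {Δ : ℕ} (hΔ : ∀ v, H.degree v ≤ Δ) (n : ℕ) (u v : V) :
    #(H.finsetWalkLength (n + 1) u v) ≤ Δ ^ n := by
  induction n generalizing u with
  | zero =>
    rw [pow_zero, card_le_one]
    intro p hp r hr
    rw [SimpleGraph.mem_finsetWalkLength_iff] at hp hr
    match p, r with
    | .cons h .nil, .cons h' .nil => rfl
  | succ n ih =>
    rw [SimpleGraph.finsetWalkLength]
    refine card_biUnion_le.trans ?_
    simp only [card_map]
    refine (sum_le_card_nsmul _ _ (Δ ^ n) fun w _ => ih _).trans ?_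
    rw [smul_eq_mul, pow_succ']
    refine Nat.mul_le_mul_right _ ?_
    rw [card_univ, SimpleGraph.card_neighborSet_eq_degree]
    exact hΔ u

open Finset Classical in
/-- The average, over all `q`-colourings `f` of the pairs, of the number of vertices lying on short
cycles all of whose edges have colour `0`. -/
theorem SimpleGraph.sum_card_short_cycle_le {V : Type*} [Fintype V] [DecidableEq V]
    (H : SimpleGraph V) [DecidableRel H.Adj] {g q C : ℕ} [NeZero q] (hC : 1 ≤ C)
    (hΔ : ∀ v, H.degree v ≤ C * q) (hq : 4 * (g * C ^ g) ≤ q) :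
    4 * ∑ f : Sym2 V → Fin q, #{v | ∃ l < g, ∃ c ∈ H.finsetWalkLength l v v,
        c.IsCycle ∧ ∀ e ∈ c.edges, f e = 0} ≤
      Fintype.card V * q ^ Fintype.card (Sym2 V) := by
  classical
  set K := Fintype.card (Sym2 V)
  have hq0 : 0 < q := Nat.pos_of_ne_zero (NeZero.ne q)
  have key : ∀ (v : V) (l : ℕ), l < g →
      q * ∑ c ∈ H.finsetWalkLength l v v,
        #{f : Sym2 V → Fin q | c.IsCycle ∧ ∀ e ∈ c.edges, f e = 0} ≤ C ^ g * q ^ K := by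
    intro v l hl
    rcases l with _ | l
    · refine le_of_eq_of_le ?_ (Nat.zero_le _)
      rw [mul_eq_zero]
      right
      refine sum_eq_zero fun c hc => ?_
      rw [card_eq_zero, filter_eq_empty_iff]
      rintro f - ⟨h, -⟩
      have := h.three_le_length
      rw [SimpleGraph.mem_finsetWalkLength_iff] at hc
      omega
    -- A cycle has `l + 1` distinct edges, so it survives for a fraction `q ^ (-(l + 1))` of the
    -- colourings. There are at most `(C * q) ^ l` closed walks, which leaves `C ^ l / q`.
    · have h1 : ∀ c ∈ H.finsetWalkLength (l + 1) v v,
          #{f : Sym2 V → Fin q | c.IsCycle ∧ ∀ e ∈ c.edges, f e = 0} * q ^ (l + 1) ≤ q ^ K := by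
        intro c hc
        rw [SimpleGraph.mem_finsetWalkLength_iff] at hc
        by_cases hcy : c.IsCycle
        · have := card_filter_forall_mem c.edges.toFinset ({0} : Finset (Fin q))
          rw [List.toFinset_card_of_nodup hcy.edges_nodup, SimpleGraph.Walk.length_edges, hc] at this
          simp only [List.mem_toFinset, mem_singleton, Fintype.card_fin, card_singleton, one_pow,
            one_mul] at this
          simp only [hcy, true_and]
          exact this.le
        · simp [hcy]
      have h2 : (q * ∑ c ∈ H.finsetWalkLength (l + 1) v v,
          #{f : Sym2 V → Fin q | c.IsCycle ∧ ∀ e ∈ c.edges, f e = 0}) * q ^ l ≤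
          (C ^ g * q ^ K) * q ^ l := by
        calc _ = ∑ c ∈ H.finsetWalkLength (l + 1) v v,
            #{f : Sym2 V → Fin q | c.IsCycle ∧ ∀ e ∈ c.edges, f e = 0} * q ^ (l + 1) := by
              rw [← sum_mul]; ring
          _ ≤ #(H.finsetWalkLength (l + 1) v v) * q ^ K := by
              rw [← smul_eq_mul]; exact sum_le_card_nsmul _ _ _ h1
          _ ≤ (C * q) ^ l * q ^ K :=
              Nat.mul_le_mul_right _ (H.card_finsetWalkLength_succ_le hΔ l v v)
          _ = C ^ l * q ^ K * q ^ l := by rw [mul_pow]; ring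
          _ ≤ _ := by
              have := Nat.pow_le_pow_right hC (show l ≤ g by omega)
              gcongr
      exact Nat.le_of_mul_le_mul_right h2 (pow_pos hq0 l)
  have h3 : ∑ f : Sym2 V → Fin q, #{v | ∃ l < g, ∃ c ∈ H.finsetWalkLength l v v,
        c.IsCycle ∧ ∀ e ∈ c.edges, f e = 0} ≤
      ∑ v : V, ∑ l ∈ range g, ∑ c ∈ H.finsetWalkLength l v v,
        #{f : Sym2 V → Fin q | c.IsCycle ∧ ∀ e ∈ c.edges, f e = 0} := by
    simp only [card_filter]
    rw [sum_comm]
    refine sum_le_sum fun v _ => ?_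
    have : ∀ l ∈ range g, ∑ c ∈ H.finsetWalkLength l v v, ∑ f : Sym2 V → Fin q,
        (if c.IsCycle ∧ ∀ e ∈ c.edges, f e = 0 then 1 else 0) =
        ∑ f : Sym2 V → Fin q, ∑ c ∈ H.finsetWalkLength l v v,
        (if c.IsCycle ∧ ∀ e ∈ c.edges, f e = 0 then 1 else 0) := fun l _ => sum_comm
    rw [sum_congr rfl this, sum_comm]
    refine sum_le_sum fun f _ => ?_
    split_ifs with h
    · obtain ⟨l, hl, c, hc, h⟩ := h
      calc 1 = if c.IsCycle ∧ ∀ e ∈ c.edges, f e = 0 then 1 else 0 := by rw [if_pos h]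
        _ ≤ _ := single_le_sum (f := fun c : H.Walk v v =>
            if c.IsCycle ∧ ∀ e ∈ c.edges, f e = 0 then 1 else 0) (fun _ _ => Nat.zero_le _) hc
        _ ≤ _ := single_le_sum (f := fun l => ∑ c ∈ H.finsetWalkLength l v v,
            if c.IsCycle ∧ ∀ e ∈ c.edges, f e = 0 then 1 else 0) (fun _ _ => Nat.zero_le _)
            (mem_range.2 hl)
    · exact Nat.zero_le _
  refine Nat.le_of_mul_le_mul_left ?_ hq0
  calc _ ≤ q * (4 * ∑ v : V, ∑ l ∈ range g, ∑ c ∈ H.finsetWalkLength l v v,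
        #{f : Sym2 V → Fin q | c.IsCycle ∧ ∀ e ∈ c.edges, f e = 0}) := by gcongr
    _ = 4 * ∑ v : V, ∑ l ∈ range g, q * ∑ c ∈ H.finsetWalkLength l v v,
        #{f : Sym2 V → Fin q | c.IsCycle ∧ ∀ e ∈ c.edges, f e = 0} := by
        simp only [mul_sum]; simp only [mul_left_comm]
    _ ≤ 4 * ∑ v : V, ∑ l ∈ range g, C ^ g * q ^ K := by
        exact Nat.mul_le_mul_left _
          (sum_le_sum fun v _ => sum_le_sum fun l hl => key v l (mem_range.1 hl))
    _ = (4 * (g * C ^ g)) * (Fintype.card V * q ^ K) := by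
        simp only [sum_const, card_univ, card_range, smul_eq_mul]; ring
    _ ≤ _ := by gcongr

open Finset in
/-- The number of `q`-colourings for which some set rich in edges misses colour `0`. -/
theorem SimpleGraph.card_exists_avoiding_lt {V : Type*} [Fintype V] [Nonempty V] [DecidableEq V]
    {q : ℕ} [NeZero q] (P : Finset V → Prop) (T : Finset V → Finset (Sym2 V))
    (hT : ∀ S, P S → 2 * q * Fintype.card V ≤ #(T S)) [DecidablePred P] :
    2 * #{f : Sym2 V → Fin q | ∃ S, P S ∧ ∀ e ∈ T S, f e ≠ 0} < q ^ Fintype.card (Sym2 V) := by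
  classical
  set K := Fintype.card (Sym2 V)
  set N := Fintype.card V
  have hN : 1 ≤ N := Fintype.card_pos
  have hq0 : 0 < q := Nat.pos_of_ne_zero (NeZero.ne q)
  have hq0' : (0 : ℝ) < q := by exact_mod_cast hq0
  -- Since `1 - 1/q ≤ exp (-1/q)`, missing `2 * q * N` pairs has probability at most `exp (-2 * N)`,
  -- which beats the `2 ^ N` choices of `S`.
  have hb : ∀ S, P S → (#{f : Sym2 V → Fin q | ∀ e ∈ T S, f e ≠ 0} : ℝ) ≤
      Real.exp (-2) ^ N * q ^ K := by
    intro S hS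
    have h := card_filter_forall_mem (T S) ({0}ᶜ : Finset (Fin q))
    simp only [mem_compl, mem_singleton, Fintype.card_fin, card_compl, card_singleton] at h
    have h' : (#{f : Sym2 V → Fin q | ∀ e ∈ T S, f e ≠ 0} : ℝ) * (q : ℝ) ^ #(T S) =
        ((q : ℝ) - 1) ^ #(T S) * (q : ℝ) ^ K := by
      rw [← Nat.cast_one, ← Nat.cast_sub hq0]; exact_mod_cast h
    have h2 : (#{f : Sym2 V → Fin q | ∀ e ∈ T S, f e ≠ 0} : ℝ) =
        (1 - 1 / (q : ℝ)) ^ #(T S) * (q : ℝ) ^ K := by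
      have : (1 - 1 / (q : ℝ)) = ((q : ℝ) - 1) / q := by field_simp
      rw [this, div_pow]
      field_simp
      linarith [h']
    rw [h2]
    have h3 : (0 : ℝ) ≤ 1 - 1 / q := by
      rw [sub_nonneg, div_le_one hq0']; exact_mod_cast hq0
    gcongr
    calc (1 - 1 / (q : ℝ)) ^ #(T S) ≤ Real.exp (-(1 / q)) ^ #(T S) := by
          gcongr
          linarith [Real.add_one_le_exp (-(1 / (q : ℝ)))]
      _ ≤ Real.exp (-(1 / q)) ^ (2 * q * N) := by
          refine pow_le_pow_of_le_one (Real.exp_pos _).le ?_ (hT S hS)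
          rw [Real.exp_le_one_iff]
          simp
      _ = _ := by
          rw [← Real.exp_nat_mul, ← Real.exp_nat_mul]
          congr 1
          push_cast
          field_simp
  have hu : ({f : Sym2 V → Fin q | ∃ S, P S ∧ ∀ e ∈ T S, f e ≠ 0} : Finset (Sym2 V → Fin q)) ⊆
      ({S | P S} : Finset (Finset V)).biUnion
        (fun S => {f : Sym2 V → Fin q | ∀ e ∈ T S, f e ≠ 0}) := by
    intro f
    simp
  have hc : (#{f : Sym2 V → Fin q | ∃ S, P S ∧ ∀ e ∈ T S, f e ≠ 0} : ℝ) ≤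
      2 ^ N * (Real.exp (-2) ^ N * q ^ K) := by
    calc _ ≤ ((∑ S ∈ ({S | P S} : Finset (Finset V)),
          #{f : Sym2 V → Fin q | ∀ e ∈ T S, f e ≠ 0} : ℕ) : ℝ) := by
          exact_mod_cast (card_le_card hu).trans card_biUnion_le
      _ ≤ #({S | P S} : Finset (Finset V)) • (Real.exp (-2) ^ N * q ^ K) := by
          push_cast
          exact sum_le_card_nsmul _ _ _ fun S hS => hb S (mem_filter.1 hS).2
      _ ≤ _ := by
          rw [nsmul_eq_mul]
          gcongr
          have : #({S | P S} : Finset (Finset V)) ≤ 2 ^ N := by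
            refine (card_le_univ _).trans ?_
            rw [Fintype.card_finset]
          exact_mod_cast this
  have he : 2 * Real.exp (-2) < 1 / 2 := by
    have h1 := Real.exp_one_gt_d9
    have : Real.exp (-2) * (Real.exp 1 * Real.exp 1) = 1 := by
      rw [← Real.exp_add, ← Real.exp_add]; norm_num
    nlinarith [Real.exp_pos (-2)]
  have hp : (2 * Real.exp (-2)) ^ N < 1 / 2 := by
    refine lt_of_le_of_lt (pow_le_of_le_one (by positivity) (by linarith) (by omega)) he
  have hfin : (2 : ℝ) * #{f : Sym2 V → Fin q | ∃ S, P S ∧ ∀ e ∈ T S, f e ≠ 0} < q ^ K := by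
    have hqK : (0 : ℝ) < q ^ K := by positivity
    rw [← mul_assoc, ← mul_pow] at hc
    nlinarith
  exact_mod_cast hfin

open Finset in
/-- Random sparsification followed by deletion of the vertices on short cycles. -/
theorem SimpleGraph.exists_sparse_subgraph {V : Type*} [Fintype V] [Nonempty V] [DecidableEq V]
    (H : SimpleGraph V) {g q C : ℕ} (hq0 : 0 < q) (hC : 1 ≤ C)
    (hΔ : ∀ v, (H.neighborSet v).ncard ≤ C * q) (hq : 4 * (g * C ^ g) ≤ q)
    (P : Finset V → Prop) (T : Finset V → Finset (Sym2 V))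
    (hTH : ∀ S, ∀ e ∈ T S, e ∈ H.edgeSet ∧ ∀ x ∈ e, x ∈ S)
    (hT : ∀ S, P S → 2 * q * Fintype.card V ≤ #(T S)) :
    ∃ (W : Finset V) (K : SimpleGraph V), K ≤ H ∧ Fintype.card V ≤ 2 * #W ∧
      (g : ℕ∞) ≤ (K.induce (W : Set V)).egirth ∧
      ∀ S : Finset V, K.IsIndepSet (S : Set V) → ¬ P S := by
  classical
  have : NeZero q := ⟨hq0.ne'⟩
  have hΔ' : ∀ v, H.degree v ≤ C * q := fun v => by
    rw [← SimpleGraph.card_neighborSet_eq_degree, ← Nat.card_eq_fintype_card]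
    exact hΔ v
  let B : (Sym2 V → Fin q) → Finset V := fun f =>
    {v | ∃ l < g, ∃ c ∈ H.finsetWalkLength l v v, c.IsCycle ∧ ∀ e ∈ c.edges, f e = 0}
  have h1 : 4 * ∑ f : Sym2 V → Fin q, #(B f) ≤
      Fintype.card V * q ^ Fintype.card (Sym2 V) := H.sum_card_short_cycle_le hC hΔ' hq
  have h2 := SimpleGraph.card_exists_avoiding_lt (q := q) P T hT
  set N := Fintype.card V
  have hN : 0 < N := Fintype.card_pos
  obtain ⟨f, hf1, hf2⟩ : ∃ f : Sym2 V → Fin q, 2 * #(B f) ≤ N ∧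
      ¬ ∃ S, P S ∧ ∀ e ∈ T S, f e ≠ 0 := by
    by_contra! hcon
    set X : Finset (Sym2 V → Fin q) := {f | ∃ S, P S ∧ ∀ e ∈ T S, f e ≠ 0} with hX
    -- Markov's inequality: more than half of the vertices are bad for at most half of the
    -- colourings, and `X` is strictly less than half.
    have h3 : #Xᶜ * N ≤ 2 * ∑ f : Sym2 V → Fin q, #(B f) := by
      calc #Xᶜ * N ≤ ∑ f ∈ Xᶜ, 2 * #(B f) := by
            rw [← smul_eq_mul]
            refine card_nsmul_le_sum _ _ _ fun f hf => ?_
            by_contra! hlt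
            obtain ⟨S, hS⟩ := hcon f hlt.le
            simp only [hX, mem_compl, mem_filter, mem_univ, true_and] at hf
            exact hf ⟨S, hS⟩
        _ ≤ ∑ f, 2 * #(B f) := sum_le_sum_of_subset (subset_univ _)
        _ = _ := by rw [mul_sum]
    have h4 : #Xᶜ + #X = q ^ Fintype.card (Sym2 V) := by
      rw [card_compl_add_card]; simp
    have h5 : 2 * #Xᶜ ≤ q ^ Fintype.card (Sym2 V) :=
      Nat.le_of_mul_le_mul_left (by nlinarith) hN
    omega
  let K : SimpleGraph V := H ⊓ SimpleGraph.fromEdgeSet {e | f e = 0}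
  have hKH : K ≤ H := inf_le_left
  refine ⟨(B f)ᶜ, K, hKH, ?_, ?_, ?_⟩
  · have := card_compl_add_card (B f)
    omega
  · rw [SimpleGraph.le_egirth]
    intro a w hw
    by_contra! hlt
    have hlt' : w.length < g := by exact_mod_cast hlt
    let i := SimpleGraph.Embedding.induce (G := K) ((↑(B f)ᶜ : Set V))
    have hw' : (w.map i.toHom).IsCycle := hw.map i.injective
    have ha : i.toHom a ∉ B f := by
      have := a.2
      rw [mem_coe, mem_compl] at this
      exact this
    apply ha
    simp only [B, mem_filter, mem_univ, true_and]
    refine ⟨w.length, hlt', (w.map i.toHom).mapLe hKH, ?_, hw'.mapLe hKH, ?_⟩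
    · exact SimpleGraph.mem_finsetWalkLength_iff.2
        ((SimpleGraph.Walk.length_map _ _).trans (SimpleGraph.Walk.length_map _ _))
    · intro e he
      replace he := (SimpleGraph.Walk.edges_mapLe_eq_edges hKH (p := w.map i.toHom)) ▸ he
      have := SimpleGraph.Walk.edges_subset_edgeSet _ he
      simp only [K, SimpleGraph.edgeSet_inf, SimpleGraph.edgeSet_fromEdgeSet] at this
      exact this.2.1
  · intro S hS hP
    apply hf2
    refine ⟨S, hP, fun e he h0 => ?_⟩
    obtain ⟨he1, he2⟩ := hTH S e he
    induction e with | _ x y => ?_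
    rw [SimpleGraph.mem_edgeSet] at he1
    refine hS (he2 x (by simp)) (he2 y (by simp)) he1.ne ⟨he1, ?_⟩
    rw [SimpleGraph.fromEdgeSet_adj]
    exact ⟨h0, he1.ne⟩

/-! ### Box powers and edges inside dense sets. -/

/-- The Cartesian (box) power of a graph: tuples are adjacent when they differ in one coordinate
only and are adjacent there. -/
def SimpleGraph.boxPower {V : Type*} (G : SimpleGraph V) (m : ℕ) : SimpleGraph (Fin m → V) where
  Adj x y := ∃ i, G.Adj (x i) (y i) ∧ ∀ j, j ≠ i → x j = y j
  symm := ⟨fun _ _ ⟨i, h, h'⟩ => ⟨i, h.symm, fun j hj => (h' j hj).symm⟩⟩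
  loopless := ⟨fun _ ⟨_, h, _⟩ => h.ne rfl⟩

theorem SimpleGraph.ncard_neighborSet_boxPower_le {V : Type*} [Fintype V] (G : SimpleGraph V)
    (m : ℕ) (x : Fin m → V) :
    ((G.boxPower m).neighborSet x).ncard ≤ m * Fintype.card V := by
  classical
  have h : (G.boxPower m).neighborSet x ⊆
      Set.range (fun p : Fin m × V => Function.update x p.1 p.2) := by
    rintro y ⟨i, -, hy⟩
    refine ⟨(i, y i), ?_⟩
    ext j
    by_cases hj : j = i
    · subst hj; simp
    · simp [hj, hy j hj]
  refine (Set.ncard_le_ncard h (Set.finite_range _)).trans ?_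
  rw [← Set.image_univ]
  refine (Set.ncard_image_le Set.finite_univ).trans ?_
  simp [Set.ncard_univ]

-- Exchanging `z i` with `v` is an involution on the pairs `(z, v)`.
open Finset in
theorem sum_card_update_mem {ι V : Type*} [Fintype ι] [DecidableEq ι] [Fintype V] [DecidableEq V]
    (S : Finset (ι → V)) (i : ι) :
    ∑ z : ι → V, #{v | Function.update z i v ∈ S} = Fintype.card V * #S := by
  let φ : (ι → V) × V → (ι → V) × V := fun p => (Function.update p.1 i p.2, p.1 i)
  have hφ : Function.Involutive φ := by
    rintro ⟨z, v⟩
    simp [φ]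
  simp only [card_filter]
  rw [← Fintype.sum_prod_type' (f := fun (z : ι → V) (v : V) =>
    if Function.update z i v ∈ S then 1 else 0)]
  rw [← hφ.bijective.sum_comp (fun p : (ι → V) × V => if Function.update p.1 i p.2 ∈ S then 1 else 0)]
  simp only [φ, Function.update_idem, Function.update_eq_self, Fintype.sum_prod_type]
  rw [sum_comm]
  simp

open Finset Classical in
/-- Sets whose density is twice the independence ratio span many edges of the box power. -/
theorem SimpleGraph.card_edges_boxPower_ge {V : Type*} [Fintype V] [Nonempty V]
    (G : SimpleGraph V) {a : ℕ} (ha : 1 ≤ a)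
    (hG : ∀ S : Finset V, G.IsIndepSet (S : Set V) → #S ≤ a) (m : ℕ) (S : Finset (Fin m → V))
    (hS : 2 * a * Fintype.card (Fin m → V) ≤ Fintype.card V * #S) :
    m * Fintype.card (Fin m → V) ≤ Fintype.card V ^ 2 *
      #{e : Sym2 (Fin m → V) | e ∈ (G.boxPower m).edgeSet ∧ ∀ x ∈ e, x ∈ S} := by
  set N := Fintype.card (Fin m → V)
  set M := Fintype.card V
  set T : Finset (Sym2 (Fin m → V)) := {e | e ∈ (G.boxPower m).edgeSet ∧ ∀ x ∈ e, x ∈ S} with hT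
  let c : Fin m → (Fin m → V) → ℕ := fun i z => #{v | Function.update z i v ∈ S}
  -- The lines in direction `i` meet `S` in at least `2 * a` points on average, so many meet it in
  -- more than `a` and therefore carry an edge inside `S`.
  have hrich : ∀ i, N ≤ M * #{z | a < c i z} := by
    intro i
    have h1 : ∑ z, c i z = M * #S := sum_card_update_mem S i
    have h2 : ∑ z, c i z ≤ ∑ z, (a + if a < c i z then M else 0) := by
      refine sum_le_sum fun z _ => ?_
      split_ifs with h
      · exact (card_le_univ _).trans (Nat.le_add_left _ _)
      · omega
    rw [sum_add_distrib, ← sum_filter, sum_const, sum_const, card_univ, smul_eq_mul,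
      smul_eq_mul] at h2
    change _ ≤ N * a + _ at h2
    nlinarith
  have hex : ∀ p : Fin m × (Fin m → V), a < c p.1 p.2 → ∃ u v, G.Adj u v ∧
      Function.update p.2 p.1 u ∈ S ∧ Function.update p.2 p.1 v ∈ S := by
    intro p hp
    by_contra! hcon
    refine absurd (hG {v | Function.update p.2 p.1 v ∈ S} ?_) (not_le.2 hp)
    intro u hu v hv _ huv
    simp only [coe_filter, mem_univ, true_and, Set.mem_ofPred_eq] at hu hv
    exact hcon u v huv hu hv
  choose! u v huv hu hv using hex
  set R : Finset (Fin m × (Fin m → V)) := {p | a < c p.1 p.2} with hR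
  have hRcard : m * N ≤ M * #R := by
    have : #R = ∑ i, #{z | a < c i z} := by
      simp only [hR, card_filter, Fintype.sum_prod_type]
    rw [this, mul_sum]
    calc m * N = ∑ _i : Fin m, N := by simp
      _ ≤ _ := sum_le_sum fun i _ => hrich i
  -- An edge determines its direction and its line; the coordinate `p.2 p.1` then recovers the base
  -- point.
  have hinj : #R ≤ #(T ×ˢ (univ : Finset V)) := by
    refine card_le_card_of_injOn (fun p => (s(Function.update p.2 p.1 (u p),
      Function.update p.2 p.1 (v p)), p.2 p.1)) ?_ ?_
    · intro p hp
      have hp' : a < c p.1 p.2 := by simpa [hR] using hp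
      simp only [coe_product, coe_univ, Set.mem_prod, Set.mem_univ, and_true, hT, mem_coe,
        mem_filter, mem_univ, true_and, SimpleGraph.mem_edgeSet, Sym2.mem_iff, forall_eq_or_imp,
        forall_eq]
      refine ⟨⟨p.1, by simpa using huv p hp', fun j hj => by simp [hj]⟩, hu p hp', hv p hp'⟩
    · rintro ⟨i, z⟩ hp ⟨i', z'⟩ hp' heq
      have hne : u (i, z) ≠ v (i, z) := (huv (i, z) (by simpa [hR] using hp)).ne
      simp only [Prod.mk.injEq, Sym2.eq_iff] at heq
      obtain ⟨h, hz⟩ := heq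
      have hii : i = i' := by
        by_contra hii
        apply hne
        rcases h with ⟨h1, h2⟩ | ⟨h1, h2⟩ <;>
        · have h1 := congrFun h1 i
          have h2 := congrFun h2 i
          simp only [Function.update_self, Function.update_of_ne hii] at h1 h2
          rw [h1, h2]
      subst hii
      simp only [Prod.mk.injEq, true_and]
      ext j
      by_cases hj : j = i
      · subst hj; exact hz
      · rcases h with ⟨h1, -⟩ | ⟨h1, -⟩ <;>
        · have h1 := congrFun h1 j
          simpa only [Function.update_of_ne hj] using h1
  rw [card_product, card_univ] at hinj
  calc m * N ≤ M * #R := hRcard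
    _ ≤ M * (#T * M) := Nat.mul_le_mul_left _ hinj
    _ = _ := by ring

open Finset in
/-- A graph with independence ratio `a / |V|` has a box power with a subgraph of large girth and
chromatic number at least `|V| / (4 a)`. -/
theorem SimpleGraph.exists_boxPower_subgraph {V : Type*} [Fintype V] [Nonempty V]
    (G : SimpleGraph V) {a : ℕ} (ha : 1 ≤ a)
    (hG : ∀ S : Finset V, G.IsIndepSet (S : Set V) → #S ≤ a) (g : ℕ) :
    ∃ (m : ℕ) (W : Finset (Fin m → V)) (K : SimpleGraph (Fin m → V)), K ≤ G.boxPower m ∧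
      (g : ℕ∞) ≤ (K.induce (W : Set (Fin m → V))).egirth ∧
      ∀ k : ℕ, (K.induce (W : Set (Fin m → V))).Colorable k → Fintype.card V ≤ 4 * a * k := by
  classical
  set M := Fintype.card V with hM
  have hM0 : 1 ≤ M := Fintype.card_pos
  -- With these values the degree bound `m * M` equals `C * q`, and `m * N / M ^ 2` equals `2 * q *
  -- N`. Since `C` does not involve `m`, the choice of `q` is not circular.
  set C := 2 * M ^ 3 with hC
  have hC1 : 1 ≤ C := by have := Nat.pow_le_pow_left hM0 3; omega
  set q := 4 * (g * C ^ g) + 1 with hq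
  set m := 2 * q * M ^ 2 with hm
  obtain ⟨W, K, hK, hW, hgirth, hind⟩ := (G.boxPower m).exists_sparse_subgraph (g := g) (q := q)
    (C := C) (by omega) hC1
    (fun x => (G.ncard_neighborSet_boxPower_le m x).trans (le_of_eq (by rw [hm, hC]; ring)))
    (by omega)
    (fun S => 2 * a * Fintype.card (Fin m → V) ≤ M * #S)
    (fun S => {e | e ∈ (G.boxPower m).edgeSet ∧ ∀ x ∈ e, x ∈ S})
    (fun S e he => by simpa using he)
    (fun S hS => by
      have h := G.card_edges_boxPower_ge ha hG m S hS
      have hM2 : 0 < M ^ 2 := by positivity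
      refine Nat.le_of_mul_le_mul_left (le_trans (le_of_eq ?_) h) hM2
      rw [hm]; ring)
  refine ⟨m, W, K, hK, hgirth, fun k ⟨col⟩ => ?_⟩
  set N := Fintype.card (Fin m → V)
  have hN : 0 < N := Fintype.card_pos
  have hclass : ∀ i : Fin k, M * #(W.attach.filter (fun x => col ⟨x.1, x.2⟩ = i)) ≤ 2 * a * N := by
    intro i
    by_contra! hlt
    refine hind ((W.attach.filter (fun x => col ⟨x.1, x.2⟩ = i)).image Subtype.val) ?_ ?_
    · intro x hx y hy _ hxy
      simp only [coe_image, coe_filter, mem_attach, true_and, Set.mem_image, Set.mem_ofPred_eq,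
        Subtype.exists] at hx hy
      obtain ⟨x', hx', hxc, rfl⟩ := hx
      obtain ⟨y', hy', hyc, rfl⟩ := hy
      have hadj : (K.induce (W : Set (Fin m → V))).Adj ⟨x', hx'⟩ ⟨y', hy'⟩ := hxy
      exact col.valid hadj (hxc.trans hyc.symm)
    · rw [card_image_of_injective _ Subtype.val_injective]
      exact hlt.le
  have hsum : #W = ∑ i : Fin k, #(W.attach.filter (fun x => col ⟨x.1, x.2⟩ = i)) := by
    rw [← card_eq_sum_card_fiberwise (fun _ _ => mem_coe.2 (mem_univ _)), card_attach]
  have h1 : M * #W ≤ k * (2 * a * N) := by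
    rw [hsum, mul_sum]
    exact (sum_le_card_nsmul _ _ _ fun i _ => hclass i).trans (by simp)
  refine Nat.le_of_mul_le_mul_left ?_ hN
  nlinarith

/-! ### Generic isometries. -/

/-- A generic reflection avoids finitely many incidences `R u = w` with `u ≠ 0`. -/
theorem exists_linearIsometryEquiv_apply_ne {E : Type*} [NormedAddCommGroup E]
    [InnerProductSpace ℝ E] (hE : 2 ≤ Module.finrank ℝ E)
    {s : Set (E × E)} (hs : s.Finite) (h0 : ∀ p ∈ s, p.1 ≠ 0) :
    ∃ R : E ≃ₗᵢ[ℝ] E, ∀ p ∈ s, R p.1 ≠ p.2 := by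
  classical
  -- If reflection in the line of `b` sends `u` to `w`, then `u + w` is twice the projection of `u`
  -- to that line. So either `b` is orthogonal to `u`, or `b` lies in the span of `u + w`; in
  -- dimension at least 2 these are proper subspaces.
  let X : Finset (Submodule ℝ E) :=
    hs.toFinset.image (fun p => ℝ ∙ (p.1 + p.2)) ∪ hs.toFinset.image (fun p => (ℝ ∙ p.1)ᗮ)
  have hX : ⊤ ∉ X := by
    simp only [X, Finset.mem_union, Finset.mem_image, Set.Finite.mem_toFinset, not_or, not_exists,
      not_and]
    refine ⟨fun p _ hp => ?_, fun p hp hp' => h0 p hp ?_⟩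
    · have h1 := finrank_span_le_card (R := ℝ) ({p.1 + p.2} : Set E)
      rw [hp, finrank_top, Set.toFinset_singleton, Finset.card_singleton] at h1
      omega
    · have h1 : p.1 ∈ (ℝ ∙ p.1)ᗮ := hp' ▸ Submodule.mem_top
      rw [Submodule.mem_orthogonal_singleton_iff_inner_right] at h1
      exact inner_self_eq_zero.1 h1
  obtain ⟨b, hb⟩ := (Set.ne_univ_iff_exists_notMem _).1 (Subspace.biUnion_ne_univ_of_top_notMem hX)
  simp only [X, Set.mem_iUnion, SetLike.mem_coe, exists_prop, not_exists, not_and,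
    Finset.mem_union, Finset.mem_image, Set.Finite.mem_toFinset] at hb
  refine ⟨(ℝ ∙ b).reflection, fun p hp heq => ?_⟩
  have h1 := hb _ (Or.inl ⟨p, hp, rfl⟩)
  have h2 := hb _ (Or.inr ⟨p, hp, rfl⟩)
  rw [Submodule.mem_orthogonal_singleton_iff_inner_left] at h2
  have hb0 : ‖b‖ ≠ 0 := by
    rw [norm_ne_zero_iff]
    rintro rfl
    simp at h2
  rw [Submodule.reflection_singleton_apply] at heq
  apply h1
  rw [← heq]
  set c : ℝ := inner ℝ b p.1 / (‖b‖ : ℝ) ^ 2 with hc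
  have hc0 : c ≠ 0 := div_ne_zero h2 (pow_ne_zero 2 hb0)
  rw [Submodule.mem_span_singleton]
  refine ⟨(2 * c)⁻¹, ?_⟩
  have : p.1 + ((2 : ℕ) • (c • b) - p.1) = (2 * c) • b := by
    rw [two_nsmul, two_mul, add_smul]; abel
  refine (congrArg _ this).trans ?_
  rw [smul_smul, inv_mul_cancel₀ (mul_ne_zero two_ne_zero hc0), one_smul]

theorem exists_linearIsometryEquiv_sum_injective {E V : Type*} [NormedAddCommGroup E]
    [InnerProductSpace ℝ E] (hE : 2 ≤ Module.finrank ℝ E) [Finite V] {φ : V → E}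
    (hφ : Function.Injective φ) (m : ℕ) :
    ∃ R : Fin m → (E ≃ₗᵢ[ℝ] E), Function.Injective (fun x : Fin m → V => ∑ i, R i (φ (x i))) := by
  induction m with
  | zero => exact ⟨fun _ => LinearIsometryEquiv.refl ℝ E, fun x y _ => Subsingleton.elim x y⟩
  | succ m ih =>
    obtain ⟨R, hR⟩ := ih
    let ψ : (Fin m → V) → E := fun x => ∑ i, R i (φ (x i))
    let s : Set (E × E) := (fun q : (V × V) × ((Fin m → V) × (Fin m → V)) =>
      (φ q.1.1 - φ q.1.2, ψ q.2.2 - ψ q.2.1)) '' {q | q.1.1 ≠ q.1.2}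
    obtain ⟨R₀, hR₀⟩ := exists_linearIsometryEquiv_apply_ne hE (s := s)
      ((Set.toFinite _).image _) (by
        rintro _ ⟨q, hq, rfl⟩
        exact sub_ne_zero.2 fun h => hq (hφ h))
    refine ⟨Fin.cons R₀ R, fun x y hxy => ?_⟩
    simp only [Fin.sum_univ_succ, Fin.cons_zero, Fin.cons_succ] at hxy
    change R₀ (φ (x 0)) + ψ (fun i => x i.succ) = R₀ (φ (y 0)) + ψ (fun i => y i.succ) at hxy
    by_cases h : x 0 = y 0
    · rw [h, add_right_inj] at hxy
      have h2 := hR hxy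
      ext i
      refine Fin.cases h (fun j => congrFun h2 j) i
    · refine absurd ?_ (hR₀ _ ⟨((x 0, y 0), (fun i => x i.succ, fun i => y i.succ)), h, rfl⟩)
      rw [map_sub, sub_eq_sub_iff_add_eq_add, hxy, add_comm]

/-! ### The Frankl–Wilson graph. -/

/-- By Lucas, for `p ≤ x` the residue is that of `(x - p).choose (p - 1)`. It makes the Gram matrix
of an independent family the identity modulo `p`. -/
theorem Nat.Prime.cast_choose_pred {p : ℕ} (hp : p.Prime) {x : ℕ} (hx : x ≤ 2 * p - 1)
    (h : x ≠ p - 1) : ((x.choose (p - 1) : ℕ) : ZMod p) = if x = 2 * p - 1 then 1 else 0 := by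
  have : Fact p.Prime := ⟨hp⟩
  have hp1 := hp.one_lt
  rcases lt_or_ge x p with hlt | hge
  · rw [Nat.choose_eq_zero_of_lt (by omega), if_neg (by omega), Nat.cast_zero]
  · have hL := (ZMod.natCast_eq_natCast_iff _ _ _).2
      (Choose.choose_modEq_choose_mod_mul_choose_div_nat (p := p) (n := x) (k := p - 1))
    have h1 : x % p = x - p := by
      rw [Nat.mod_eq_sub_mod hge, Nat.mod_eq_of_lt (by omega)]
    have h2 : (p - 1) % p = p - 1 := Nat.mod_eq_of_lt (by omega)
    have h3 : (p - 1) / p = 0 := Nat.div_eq_of_lt (by omega)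
    rw [hL, h1, h2, h3, Nat.choose_zero_right, mul_one]
    split_ifs with hx2
    · rw [show x - p = p - 1 by omega, Nat.choose_self, Nat.cast_one]
    · rw [Nat.choose_eq_zero_of_lt (by omega), Nat.cast_zero]

open Finset in
/-- Sets of size `2p - 1`, adjacent when they meet in `p - 1` points. -/
def franklWilsonGraph (n p : ℕ) : SimpleGraph {A : Finset (Fin n) // #A = 2 * p - 1} where
  Adj A B := A ≠ B ∧ #(A.1 ∩ B.1) = p - 1
  symm := ⟨fun _ _ ⟨h, h'⟩ => ⟨h.symm, by rwa [inter_comm]⟩⟩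
  loopless := ⟨fun _ ⟨h, _⟩ => h rfl⟩

open Finset in
/-- The Frankl–Wilson bound, by the rank of the inclusion matrix modulo `p`. -/
theorem card_le_choose_of_isIndepSet_franklWilsonGraph {n p : ℕ} (hp : p.Prime)
    (S : Finset {A : Finset (Fin n) // #A = 2 * p - 1})
    (hS : (franklWilsonGraph n p).IsIndepSet (S : Set {A : Finset (Fin n) // #A = 2 * p - 1})) :
    #S ≤ n.choose (p - 1) := by
  classical
  have : Fact p.Prime := ⟨hp⟩
  have hp1 := hp.one_lt
  let I : Matrix S {T : Finset (Fin n) // #T = p - 1} (ZMod p) :=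
    Matrix.of fun A T => if T.1 ⊆ A.1.1 then 1 else 0
  have hI : I * I.transpose = 1 := by
    ext A B
    rw [Matrix.mul_apply]
    have h1 : ∀ T : {T : Finset (Fin n) // #T = p - 1},
        I A T * I.transpose T B = if T.1 ⊆ A.1.1 ∩ B.1.1 then 1 else 0 := by
      intro T
      simp only [I, Matrix.transpose_apply, Matrix.of_apply, subset_inter_iff, mul_ite, mul_one,
        mul_zero]
      split_ifs <;> simp_all
    simp only [h1]
    rw [sum_boole]
    have h2 : #{T : {T : Finset (Fin n) // #T = p - 1} | T.1 ⊆ A.1.1 ∩ B.1.1} =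
        (#(A.1.1 ∩ B.1.1)).choose (p - 1) := by
      rw [← card_powersetCard, ← card_map (Function.Embedding.subtype _)]
      congr 1
      ext T
      simp [mem_powersetCard, and_comm]
    rw [h2, Matrix.one_apply]
    have hA := A.1.2
    have hB := B.1.2
    have hle : #(A.1.1 ∩ B.1.1) ≤ 2 * p - 1 := (card_le_card inter_subset_left).trans hA.le
    have hne : #(A.1.1 ∩ B.1.1) ≠ p - 1 := by
      intro h
      by_cases hAB : A.1 = B.1
      · rw [← hAB, inter_self] at h
        omega
      · exact hS A.2 B.2 hAB ⟨hAB, h⟩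
    rw [hp.cast_choose_pred hle hne]
    refine if_congr ⟨fun h => ?_, fun h => ?_⟩ rfl rfl
    · have hA' := eq_of_subset_of_card_le (inter_subset_left : A.1.1 ∩ B.1.1 ⊆ A.1.1) (by omega)
      have hB' := eq_of_subset_of_card_le (inter_subset_right : A.1.1 ∩ B.1.1 ⊆ B.1.1) (by omega)
      exact Subtype.ext (Subtype.ext (hA'.symm.trans hB'))
    · rw [← h, inter_self]; exact hA
  have h3 := Matrix.rank_mul_le_left I I.transpose
  rw [hI, Matrix.rank_one] at h3
  have h4 := h3.trans I.rank_le_card_width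
  simpa using h4

-- Adjacent sets have symmetric difference of size `2 * p`, so indicator vectors scaled by `1 /
-- √(2p)` work.
open Finset in
theorem isUnitDistanceGraph_franklWilsonGraph {n p : ℕ} (hp : 0 < p) :
    IsUnitDistanceGraph n (franklWilsonGraph n p) := by
  classical
  have hp' : (0 : ℝ) < p := by exact_mod_cast hp
  set c : ℝ := (√(2 * p))⁻¹ with hc
  have hc0 : 0 < c := by positivity
  have hc2 : c ^ 2 * (2 * p) = 1 := by
    rw [hc, inv_pow, Real.sq_sqrt (by positivity)]
    field_simp
  refine ⟨fun A => WithLp.toLp 2 fun i => if i ∈ A.1 then c else 0, fun A B h => ?_, ?_⟩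
  · apply Subtype.ext
    ext i
    have h1 := congrArg (fun f : EuclideanSpace ℝ (Fin n) => f i) h
    simp only at h1
    by_cases hA : i ∈ A.1 <;> by_cases hB : i ∈ B.1 <;> simp_all
  · rintro A B ⟨-, hAB⟩
    rw [EuclideanSpace.dist_eq, Real.sqrt_eq_one]
    have h1 : ∀ i, dist (if i ∈ A.1 then c else 0) (if i ∈ B.1 then c else 0) ^ 2 =
        if i ∈ symmDiff A.1 B.1 then c ^ 2 else 0 := by
      intro i
      rw [Real.dist_eq, sq_abs]
      by_cases hA : i ∈ A.1 <;> by_cases hB : i ∈ B.1 <;> simp [hA, hB, mem_symmDiff]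
    simp only [h1]
    rw [← sum_filter, sum_const, filter_mem_eq_inter, univ_inter, nsmul_eq_mul]
    have h2 : #(symmDiff A.1 B.1) = 2 * p := by
      have e1 := card_sdiff_add_card_inter A.1 B.1
      have e2 := card_sdiff_add_card_inter B.1 A.1
      rw [inter_comm] at e2
      have hA := A.2
      have hB := B.2
      rw [symmDiff_def, sup_eq_union, card_union_of_disjoint disjoint_sdiff_sdiff]
      omega
    rw [h2]
    push_cast
    linarith

/-! ### Ratio of binomial coefficients. -/

theorem pow_mul_choose_le {n c k : ℕ} (j : ℕ) (h : ∀ t < k + j, c * (t + 1) ≤ n - t) :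
    c ^ j * n.choose k ≤ n.choose (k + j) := by
  induction j with
  | zero => simp
  | succ j ih =>
    have h1 := ih fun t ht => h t (by omega)
    have h2 := Nat.choose_succ_right_eq n (k + j)
    have h3 := h (k + j) (by omega)
    refine Nat.le_of_mul_le_mul_left ?_ (Nat.succ_pos (k + j))
    calc (k + j + 1) * (c ^ (j + 1) * n.choose k)
        = c * (k + j + 1) * (c ^ j * n.choose k) := by ring
      _ ≤ (n - (k + j)) * n.choose (k + j) := Nat.mul_le_mul h3 h1
      _ = (k + j + 1) * n.choose (k + (j + 1)) := by rw [mul_comm, ← h2]; ring_nf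

theorem exists_prime_pow_mul_choose_le {n : ℕ} (hn : 12 ≤ n) :
    ∃ p : ℕ, p.Prime ∧ p ≤ n ∧ 2 * p - 1 ≤ n ∧
      (1.09 : ℝ) ^ n * n.choose (p - 1) ≤ n.choose (2 * p - 1) := by
  -- Bertrand's postulate gives `6 * p ≤ n < 12 * p`. The cases below rest on `1.09 ^ 12 < 3` and
  -- `1.09 ^ 8 < 2`.
  obtain ⟨p, hp, hlt, hle⟩ := Nat.exists_prime_lt_and_le_two_mul (n / 12) (by omega)
  have hp1 := hp.one_lt
  refine ⟨p, hp, by omega, by omega, ?_⟩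
  have key : ∀ c : ℕ, (1.09 : ℝ) ^ n ≤ (c : ℝ) ^ p → (∀ t < 2 * p - 1, c * (t + 1) ≤ n - t) →
      (1.09 : ℝ) ^ n * n.choose (p - 1) ≤ n.choose (2 * p - 1) := by
    intro c hc h
    have e : p - 1 + p = 2 * p - 1 := by omega
    have h1 := pow_mul_choose_le (n := n) (c := c) (k := p - 1) p (by rwa [e])
    rw [e] at h1
    calc (1.09 : ℝ) ^ n * n.choose (p - 1) ≤ (c : ℝ) ^ p * n.choose (p - 1) := by gcongr
      _ ≤ _ := by exact_mod_cast h1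
  rcases le_or_gt (8 * p) n with h8 | h8
  · refine key 3 ?_ fun t ht => by omega
    calc (1.09 : ℝ) ^ n ≤ 1.09 ^ (12 * p) := pow_le_pow_right₀ (by norm_num) (by omega)
      _ = (1.09 ^ 12) ^ p := pow_mul _ _ _
      _ ≤ _ := by gcongr; norm_num
  · refine key 2 ?_ fun t ht => by omega
    calc (1.09 : ℝ) ^ n ≤ 1.09 ^ (8 * p) := pow_le_pow_right₀ (by norm_num) (by omega)
      _ = (1.09 ^ 8) ^ p := pow_mul _ _ _
      _ ≤ _ := by gcongr; norm_num

/-! ### Unit distance embeddings and conclusion. -/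

theorem IsUnitDistanceGraph.boxPower {V : Type*} [Finite V] {d : ℕ} (hd : 2 ≤ d)
    {G : SimpleGraph V} (hG : IsUnitDistanceGraph d G) (m : ℕ) :
    IsUnitDistanceGraph d (G.boxPower m) := by
  obtain ⟨φ, hφ, hdist⟩ := hG
  obtain ⟨R, hR⟩ := exists_linearIsometryEquiv_sum_injective
    (by rwa [finrank_euclideanSpace_fin]) hφ m
  refine ⟨fun x => ∑ i, R i (φ (x i)), hR, ?_⟩
  rintro x y ⟨i, hi, hne⟩
  rw [dist_eq_norm, ← Finset.sum_sub_distrib, Finset.sum_eq_single i, ← dist_eq_norm,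
    LinearIsometryEquiv.dist_map, hdist _ _ hi]
  · intro j _ hj
    rw [hne j hj, sub_self]
  · simp

theorem IsUnitDistanceGraph.mono {V : Type*} {d : ℕ} {G H : SimpleGraph V} (h : G ≤ H)
    (hH : IsUnitDistanceGraph d H) : IsUnitDistanceGraph d G :=
  hH.imp fun _ hφ => ⟨hφ.1, fun u v huv => hφ.2 u v (h huv)⟩

theorem IsUnitDistanceGraph.of_embedding {V W : Type*} {d : ℕ} {G : SimpleGraph V}
    {H : SimpleGraph W} (f : G ↪g H) (hH : IsUnitDistanceGraph d H) : IsUnitDistanceGraph d G := by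
  obtain ⟨φ, hφ, h⟩ := hH
  exact ⟨φ ∘ f, hφ.comp f.injective, fun u v huv => h _ _ (f.map_adj_iff.2 huv)⟩

/-- Finite unit distance graphs of large girth and chromatic number at least `1.09 ^ d / 4`. -/
theorem exists_isUnitDistanceGraph_egirth_chromaticNumber {d : ℕ} (hd : 12 ≤ d) (g : ℕ) :
    ∃ (n : ℕ) (G : SimpleGraph (Fin n)), IsUnitDistanceGraph d G ∧ (g : ℕ∞) ≤ G.egirth ∧
      ∃ k : ℕ, G.chromaticNumber = (k : ℕ∞) ∧ (1.09 : ℝ) ^ d ≤ 4 * k := by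
  obtain ⟨p, hp, hpd, hpd2, hlarge⟩ := exists_prime_pow_mul_choose_le hd
  have hcard : Fintype.card {A : Finset (Fin d) // A.card = 2 * p - 1} = d.choose (2 * p - 1) := by
    simp
  have hne : Nonempty {A : Finset (Fin d) // A.card = 2 * p - 1} := by
    rw [← Fintype.card_pos_iff, hcard]
    exact Nat.choose_pos hpd2
  have ha : 0 < d.choose (p - 1) := Nat.choose_pos (by omega)
  obtain ⟨m, W, K, hK, hgirth, hcol⟩ := (franklWilsonGraph d p).exists_boxPower_subgraph ha
    (card_le_choose_of_isIndepSet_franklWilsonGraph hp) g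
  set J := K.induce (W : Set _)
  have hU : IsUnitDistanceGraph d J :=
    (((isUnitDistanceGraph_franklWilsonGraph hp.pos).boxPower (by omega) m).mono hK).of_embedding
      (SimpleGraph.Embedding.induce _)
  have e := J.overFinIso rfl
  have hC := SimpleGraph.colorable_chromaticNumber_of_fintype J
  have hne' := SimpleGraph.chromaticNumber_ne_top_iff_exists.2 ⟨_, hC⟩
  refine ⟨_, _, hU.of_embedding e.symm.toEmbedding, hgirth.trans e.egirth_eq.le, _,
    (SimpleGraph.chromaticNumber_congr e).symm.trans (ENat.natCast_toNat hne').symm, ?_⟩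
  have h1 := hcol _ hC
  rw [hcard] at h1
  have ha' : (0 : ℝ) < d.choose (p - 1) := by exact_mod_cast ha
  refine le_of_mul_le_mul_right (hlarge.trans ?_) ha'
  have h2 : (d.choose (2 * p - 1) : ℝ) ≤ 4 * d.choose (p - 1) * J.chromaticNumber.toNat := by
    exact_mod_cast h1
  linarith

theorem eventually_four_mul_pow_le : ∀ᶠ d : ℕ in atTop, 4 * (1.074 : ℝ) ^ d ≤ 1.09 ^ d := by
  filter_upwards [(tendsto_pow_atTop_atTop_of_one_lt
    (show (1 : ℝ) < 1.09 / 1.074 by norm_num)).eventually_ge_atTop 4] with d hd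
  rwa [div_pow, le_div_iff₀ (by positivity)] at hd

theorem mainTheorem2 :
    ∃ ε : ℕ → ℝ, Tendsto ε atTop (𝓝 0) ∧
      ∀ d g : ℕ, ∃ (n : ℕ) (G : SimpleGraph (Fin n)),
        IsUnitDistanceGraph d G ∧
        (g : ℕ∞) ≤ G.egirth ∧
        ∃ k : ℕ, G.chromaticNumber = (k : ℕ∞) ∧ ((1.074 : ℝ) + ε d) ^ d ≤ (k : ℝ) := by
  obtain ⟨D, hD⟩ := eventually_atTop.1 (eventually_four_mul_pow_le.and (eventually_ge_atTop 12))
  -- For small `d` the base becomes 0, and a single vertex suffices, even at `d = 0` where `0 ^ 0 =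
  -- 1`.
  refine ⟨fun d => if d < D then -1.074 else 0, ?_, fun d g => ?_⟩
  · refine tendsto_const_nhds.congr' ?_
    filter_upwards [eventually_ge_atTop D] with d hd
    rw [if_neg (not_lt.2 hd)]
  · by_cases hd : d < D
    · refine ⟨1, ⊥, ⟨fun _ => 0, fun _ _ _ => Subsingleton.elim _ _, fun u v h => h.elim⟩,
        by simp, 1, SimpleGraph.chromaticNumber_bot, ?_⟩
      simp only [if_pos hd]
      rw [add_neg_cancel, Nat.cast_one]
      exact pow_le_one₀ le_rfl zero_le_one
    · obtain ⟨h1, h2⟩ := hD d (not_lt.1 hd)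
      obtain ⟨n, G, hU, hg, k, hk, hle⟩ := exists_isUnitDistanceGraph_egirth_chromaticNumber h2 g
      refine ⟨n, G, hU, hg, k, hk, ?_⟩
      simp only [if_neg hd, add_zero]
      linarith
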